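/- Lie groups are real, finite-dimensional, smooth and Hausdorff. For a connected Lie group $M$, let $\pi_1M$ be the fundamental groupoid of $M$: its objects are the points of $M$, its arrows $x\to y$ are the homotopy classes (relative to the end points) of paths in $M$ from $x$ to $y$, and the composite $[q]\circ[p]$ is the class of $p$ followed by $q$. The set of arrows carries the group structure $[p]\cdot[q]=[t\mapsto p(t)q(t)]$ and the smooth structure lifted from $M\times M$: a basic neighbourhood of the class $a$ of a path from $x$ to $y$ consists of all classes of $\delta^{-1}\cdot a\cdot\varepsilon$, where $\delta$ is a path starting at $x$ inside a given open set $U\ni x$ and $\varepsilon$ is a path starting at $y$ inside a given open set $V\ni y$; the map (source, target) $\pi_1M\to M\times M$ is then a local homeomorphism, and the charts of $\pi_1M$ are its local homeomorphic restrictions followed by product charts of $M\times M$. A Lie groupoid is a groupoid whose arrows and objects form smooth manifolds, with Hausdorff object manifold and Hausdorff source fibres, whose source and target maps are surjective submersions and whose composition, unit and inversion maps are smooth; a morphism of Lie groupoids is a groupoid morphism $(f,f_0)$ with $f$ and $f_0$ smooth. A Lie group-groupoid is a Lie groupoid whose arrows and objects are Lie groups such that the multiplication, the unit and the inversion of these groups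 are morphisms of Lie groupoids and the interchange law $(b\circ a)(d\circ c)=(bd)\circ(ac)$ holds. A morphism of Lie group-groupoids is a morphism of Lie groupoids that preserves the group multiplication of arrows. **Proposition.** Let $f:H\to G$ be a morphism of connected Lie groups, that is, a smooth group homomorphism. Then $\pi_1H$ and $\pi_1G$ are Lie group-groupoids, and the induced map $\pi_1f:\pi_1H\to\pi_1G$, $[p]\mapsto[f\circ p]$, together with $f$ on objects, is a morphism of Lie group-groupoids. Moreover $\pi_1(\mathrm{id}_H)=\mathrm{id}$, and $\pi_1(g\circ f)=\pi_1g\circ\pi_1f$ for every morphism $g:G\to K$ of connected Lie groups, so that $\pi_1$ is a functor from connected Lie groups to Lie group-groupoids. -/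

import Mathlib

open scoped Manifold ContDiff Topology

set_option linter.unusedVariables false

noncomputable section

/-! ### Groupoids given by a set of arrows and a set of objects -/

/-- A groupoid with set of arrows `A` and set of objects `O`. The composite `comp b a h` is `b ∘ a`
(first `a`, then `b`), which is defined when the source of `b` is the target of `a`. -/
structure GroupoidOn (A O : Type*) where
  src : A → O
  tgt : A → O
  unit : O → A
  inv : A → A
  comp : (b a : A) → src b = tgt a → A
  src_comp : ∀ b a h, src (comp b a h) = src a
  tgt_comp : ∀ b a h, tgt (comp b a h) = tgt b
  assoc : ∀ (c b a : A) (hcb : src c = tgt b) (hba : src b = tgt a),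
    comp c (comp b a hba) (hcb.trans (tgt_comp b a hba).symm) =
      comp (comp c b hcb) a ((src_comp c b hcb).trans hba)
  src_unit : ∀ x, src (unit x) = x
  tgt_unit : ∀ x, tgt (unit x) = x
  comp_unit : ∀ a, comp a (unit (src a)) (tgt_unit (src a)).symm = a
  unit_comp : ∀ a, comp (unit (tgt a)) a (src_unit (tgt a)) = a
  src_inv : ∀ a, src (inv a) = tgt a
  tgt_inv : ∀ a, tgt (inv a) = src a
  inv_comp : ∀ a, comp (inv a) a (src_inv a) = unit (src a)
  comp_inv : ∀ a, comp a (inv a) (tgt_inv a).symm = unit (tgt a)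

namespace GroupoidOn

/-- The product of two groupoids, with componentwise operations. -/
def prod {A O B P : Type*} (𝒢 : GroupoidOn A O) (ℋ : GroupoidOn B P) :
    GroupoidOn (A × B) (O × P) where
  src a := (𝒢.src a.1, ℋ.src a.2)
  tgt a := (𝒢.tgt a.1, ℋ.tgt a.2)
  unit x := (𝒢.unit x.1, ℋ.unit x.2)
  inv a := (𝒢.inv a.1, ℋ.inv a.2)
  comp b a h := (𝒢.comp b.1 a.1 (congrArg Prod.fst h), ℋ.comp b.2 a.2 (congrArg Prod.snd h))
  src_comp b a h := Prod.ext (𝒢.src_comp _ _ _) (ℋ.src_comp _ _ _)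
  tgt_comp b a h := Prod.ext (𝒢.tgt_comp _ _ _) (ℋ.tgt_comp _ _ _)
  assoc c b a hcb hba := Prod.ext (𝒢.assoc _ _ _ _ _) (ℋ.assoc _ _ _ _ _)
  src_unit x := Prod.ext (𝒢.src_unit _) (ℋ.src_unit _)
  tgt_unit x := Prod.ext (𝒢.tgt_unit _) (ℋ.tgt_unit _)
  comp_unit a := Prod.ext (𝒢.comp_unit _) (ℋ.comp_unit _)
  unit_comp a := Prod.ext (𝒢.unit_comp _) (ℋ.unit_comp _)
  src_inv a := Prod.ext (𝒢.src_inv _) (ℋ.src_inv _)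
  tgt_inv a := Prod.ext (𝒢.tgt_inv _) (ℋ.tgt_inv _)
  inv_comp a := Prod.ext (𝒢.inv_comp _) (ℋ.inv_comp _)
  comp_inv a := Prod.ext (𝒢.comp_inv _) (ℋ.comp_inv _)

/-- The groupoid with one object and one arrow. -/
def point : GroupoidOn Unit Unit where
  src := id
  tgt := id
  unit := id
  inv := id
  comp _ _ _ := ()
  src_comp _ _ _ := rfl
  tgt_comp _ _ _ := rfl
  assoc _ _ _ _ _ := rfl
  src_unit _ := rfl
  tgt_unit _ := rfl
  comp_unit _ := rfl
  unit_comp _ := rfl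
  src_inv _ := rfl
  tgt_inv _ := rfl
  inv_comp _ := rfl
  comp_inv _ := rfl

open Classical in
/-- The composition `(b, a) ↦ b ∘ a` as a function on all pairs of arrows. Its value on pairs that
are not composable is irrelevant. -/
def compPair {A O : Type*} (𝒢 : GroupoidOn A O) (p : A × A) : A :=
  if h : 𝒢.src p.1 = 𝒢.tgt p.2 then 𝒢.comp p.1 p.2 h else p.1

/-- The set of composable pairs `(b, a)`. -/
def composable {A O : Type*} (𝒢 : GroupoidOn A O) : Set (A × A) :=
  {p | 𝒢.src p.1 = 𝒢.tgt p.2}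

end GroupoidOn

/-- The pair `(f, f₀)` is a morphism of groupoids. -/
structure IsGroupoidHom {A O B P : Type*} (𝒢 : GroupoidOn A O) (ℋ : GroupoidOn B P)
    (f : A → B) (f₀ : O → P) : Prop where
  src_map : ∀ a, ℋ.src (f a) = f₀ (𝒢.src a)
  tgt_map : ∀ a, ℋ.tgt (f a) = f₀ (𝒢.tgt a)
  map_comp : ∀ (b a : A) (h : 𝒢.src b = 𝒢.tgt a),
    f (𝒢.comp b a h) =
      ℋ.comp (f b) (f a) ((src_map b).trans ((congrArg f₀ h).trans (tgt_map a).symm))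

section LieGroupoid

variable {EA HA A EO HO O : Type*}
  [NormedAddCommGroup EA] [NormedSpace ℝ EA] [TopologicalSpace HA]
  [NormedAddCommGroup EO] [NormedSpace ℝ EO] [TopologicalSpace HO]
  [TopologicalSpace A] [ChartedSpace HA A] [TopologicalSpace O] [ChartedSpace HO O]
  {EB HB B EP HP P : Type*}
  [NormedAddCommGroup EB] [NormedSpace ℝ EB] [TopologicalSpace HB]
  [NormedAddCommGroup EP] [NormedSpace ℝ EP] [TopologicalSpace HP]
  [TopologicalSpace B] [ChartedSpace HB B] [TopologicalSpace P] [ChartedSpace HP P]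

/-- A groupoid is a Lie groupoid, for given charts on the arrows (model `I`) and on the objects
(model `J`): arrows and objects form smooth finite-dimensional manifolds without boundary, objects
and source fibres are Hausdorff, source and target are surjective submersions, and composition,
units and inversion are smooth. Since the source is a submersion, the composable pairs form
an embedded submanifold of `A × A`, on which smoothness is the same as `ContMDiffOn`. -/
structure IsLieGroupoid (I : ModelWithCorners ℝ EA HA) (J : ModelWithCorners ℝ EO HO)
    (𝒢 : GroupoidOn A O) : Prop where
  finiteDimensional_arrows : FiniteDimensional ℝ EA
  finiteDimensional_objects : FiniteDimensional ℝ EO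
  boundaryless_arrows : BoundarylessManifold I A
  boundaryless_objects : BoundarylessManifold J O
  isManifold_arrows : IsManifold I ∞ A
  isManifold_objects : IsManifold J ∞ O
  t2_objects : T2Space O
  t2_fibre : ∀ x : O, T2Space {a : A // 𝒢.src a = x}
  src_surjective : Function.Surjective 𝒢.src
  tgt_surjective : Function.Surjective 𝒢.tgt
  src_submersion : Manifold.IsSubmersion I J ∞ 𝒢.src
  tgt_submersion : Manifold.IsSubmersion I J ∞ 𝒢.tgt
  comp_smooth : ContMDiffOn (I.prod I) I ∞ 𝒢.compPair 𝒢.composable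
  unit_smooth : ContMDiff J I ∞ 𝒢.unit
  inv_smooth : ContMDiff I I ∞ 𝒢.inv

/-- The pair `(f, f₀)` is a morphism of Lie groupoids: a morphism of groupoids with both maps
smooth. -/
structure IsLieGroupoidHom (I : ModelWithCorners ℝ EA HA) (J : ModelWithCorners ℝ EO HO)
    (I' : ModelWithCorners ℝ EB HB) (J' : ModelWithCorners ℝ EP HP)
    (𝒢 : GroupoidOn A O) (ℋ : GroupoidOn B P) (f : A → B) (f₀ : O → P) : Prop
    extends IsGroupoidHom 𝒢 ℋ f f₀ where
  smooth_arrows : ContMDiff I I' ∞ f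
  smooth_objects : ContMDiff J J' ∞ f₀

/-- A Lie groupoid whose arrows and objects carry group structures is a Lie group-groupoid: the
arrows form a Lie group; multiplication, unit and inversion of this group (on arrows, and the
corresponding maps on objects) are morphisms of Lie groupoids; and the interchange law holds.
The unit is a morphism from the one-point groupoid, so that its smoothness is automatic. -/
structure IsLieGroupGroupoid [Group A] [Group O]
    (I : ModelWithCorners ℝ EA HA) (J : ModelWithCorners ℝ EO HO)
    (𝒢 : GroupoidOn A O) : Prop where
  lieGroupoid : IsLieGroupoid I J 𝒢
  lieGroup_arrows : LieGroup I ∞ A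
  lieGroup_objects : LieGroup J ∞ O
  mul_hom : IsLieGroupoidHom (I.prod I) (J.prod J) I J (𝒢.prod 𝒢) 𝒢
    (fun p : A × A => p.1 * p.2) (fun x : O × O => x.1 * x.2)
  one_hom : IsGroupoidHom GroupoidOn.point 𝒢 (fun _ => (1 : A)) (fun _ => (1 : O))
  inv_hom : IsLieGroupoidHom I J I J 𝒢 𝒢 (fun a : A => a⁻¹) (fun x : O => x⁻¹)
  interchange : ∀ (b a d c : A) (hba : 𝒢.src b = 𝒢.tgt a) (hdc : 𝒢.src d = 𝒢.tgt c)
    (h : 𝒢.src (b * d) = 𝒢.tgt (a * c)),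
    𝒢.comp b a hba * 𝒢.comp d c hdc = 𝒢.comp (b * d) (a * c) h

/-- The pair `(f, f₀)` is a morphism of Lie group-groupoids: a morphism of Lie groupoids which
preserves the group multiplication of the arrows. -/
structure IsLieGroupGroupoidHom [Group A] [Group B]
    (I : ModelWithCorners ℝ EA HA) (J : ModelWithCorners ℝ EO HO)
    (I' : ModelWithCorners ℝ EB HB) (J' : ModelWithCorners ℝ EP HP)
    (𝒢 : GroupoidOn A O) (ℋ : GroupoidOn B P) (f : A → B) (f₀ : O → P) : Prop
    extends IsLieGroupoidHom I J I' J' 𝒢 ℋ f f₀ where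
  map_mul : ∀ a b : A, f (a * b) = f a * f b

end LieGroupoid

/-! ### The fundamental groupoid -/

/-- The set `π₁ X` of all arrows of the fundamental groupoid of `X`: homotopy classes, relative
to the end points, of paths in `X`, with arbitrary end points. -/
structure Pi1 (X : Type*) [TopologicalSpace X] where
  src : X
  tgt : X
  cls : Path.Homotopic.Quotient src tgt

namespace Pi1

variable {X Y Z : Type*} [TopologicalSpace X] [TopologicalSpace Y] [TopologicalSpace Z]

/-- The class of a path. -/
def ofPath {x y : X} (p : Path x y) : Pi1 X := ⟨x, y, Path.Homotopic.Quotient.mk p⟩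

theorem exists_ofPath (a : Pi1 X) : ∃ p : Path a.src a.tgt, a = ofPath p := by
  obtain ⟨x, y, c⟩ := a
  induction c using Path.Homotopic.Quotient.ind with
  | mk p => exact ⟨p, rfl⟩

theorem ofPath_eq_of_homotopic {x y : X} {p q : Path x y} (h : p.Homotopic q) :
    ofPath p = ofPath q := by
  unfold ofPath
  rw [Path.Homotopic.Quotient.eq.2 h]

theorem ofPath_congr {x y x' y' : X} (p : Path x y) (q : Path x' y') (h : ∀ t, p t = q t) :
    ofPath p = ofPath q := by
  obtain rfl : x = x' := by simpa using h 0
  obtain rfl : y = y' := by simpa using h 1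
  obtain rfl : p = q := by ext t; exact h t
  rfl

/-- The composite of the class `b` after the class `a`. -/
def comp (b a : Pi1 X) (h : b.src = a.tgt) : Pi1 X :=
  ⟨a.src, b.tgt, a.cls.trans (b.cls.cast h.symm rfl)⟩

theorem comp_ofPath {x y z : X} (p : Path x y) (q : Path y z) (h : (ofPath q).src = (ofPath p).tgt) :
    comp (ofPath q) (ofPath p) h = ofPath (p.trans q) := rfl

variable (X) in
/-- The fundamental groupoid of `X`. -/
def groupoid : GroupoidOn (Pi1 X) X where
  src := src
  tgt := tgt
  unit x := ⟨x, x, Path.Homotopic.Quotient.refl x⟩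
  inv a := ⟨a.tgt, a.src, a.cls.symm⟩
  comp := comp
  src_comp _ _ _ := rfl
  tgt_comp _ _ _ := rfl
  assoc := by
    rintro ⟨_, _, c⟩ ⟨_, _, b⟩ ⟨_, _, a⟩ hcb hba
    dsimp only at hcb hba
    subst hcb hba
    simp [comp]
  src_unit _ := rfl
  tgt_unit _ := rfl
  comp_unit _ := by simp [comp]
  unit_comp _ := by simp [comp]
  src_inv _ := rfl
  tgt_inv _ := rfl
  inv_comp _ := by simp [comp]
  comp_inv _ := by simp [comp]

/-- The map `π₁ f : π₁ X → π₁ Y` induced by a continuous map `f`: it sends the class of a path `p`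
to the class of `f ∘ p`. -/
def map (f : C(X, Y)) (a : Pi1 X) : Pi1 Y := ⟨f a.src, f a.tgt, a.cls.map f⟩

theorem map_ofPath (f : C(X, Y)) {x y : X} (p : Path x y) :
    map f (ofPath p) = ofPath (p.map f.continuous) := rfl

/-! ### The group structure -/

section Group

variable [Group X] [IsTopologicalGroup X]

/-- The product of the classes of `p` and `q` is the class of `t ↦ p t * q t`. -/
instance : Mul (Pi1 X) where
  mul a b := ⟨a.src * b.src, a.tgt * b.tgt,
    (Path.Homotopic.prod a.cls b.cls).map ⟨fun z : X × X => z.1 * z.2, continuous_mul⟩⟩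

instance : One (Pi1 X) where
  one := ⟨1, 1, Path.Homotopic.Quotient.refl 1⟩

/-- The inverse of the class of `p` is the class of `t ↦ (p t)⁻¹`. -/
instance : Inv (Pi1 X) where
  inv a := ⟨a.src⁻¹, a.tgt⁻¹, a.cls.map ⟨fun x : X => x⁻¹, continuous_inv⟩⟩

theorem ofPath_mul {x y x' y' : X} (p : Path x y) (q : Path x' y') :
    ofPath p * ofPath q =
      ofPath ((p.prod q).map (f := fun z : X × X => z.1 * z.2) continuous_mul) := rfl

theorem ofPath_inv {x y : X} (p : Path x y) :
    (ofPath p)⁻¹ = ofPath (p.map (f := fun x : X => x⁻¹) continuous_inv) := rfl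

instance : Group (Pi1 X) :=
  Group.ofLeftAxioms
    (by
      intro a b c
      obtain ⟨p, hp⟩ := exists_ofPath a
      obtain ⟨q, hq⟩ := exists_ofPath b
      obtain ⟨r, hr⟩ := exists_ofPath c
      rw [hp, hq, hr]
      exact ofPath_congr _ _ fun t => mul_assoc _ _ _)
    (by
      intro a
      obtain ⟨p, hp⟩ := exists_ofPath a
      rw [hp]
      exact ofPath_congr _ _ fun t => one_mul _)
    (by
      intro a
      obtain ⟨p, hp⟩ := exists_ofPath a
      rw [hp]
      exact ofPath_congr _ _ fun t => inv_mul_cancel _)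

end Group

/-! ### The lifted topology -/

/-- The class `δ⁻¹ · a · ε`: first run backwards through `δ`, then through `a`, then
through `ε`. -/
def extend (a : Pi1 X) {x y : X} (δ : Path a.src x) (ε : Path a.tgt y) : Pi1 X :=
  ⟨x, y, (Path.Homotopic.Quotient.mk δ).symm.trans
    (a.cls.trans (Path.Homotopic.Quotient.mk ε))⟩

/-- The lifted topology on `π₁ X`: a basic neighbourhood of a class `a` from `x` to `y` is given by
open sets `U ∋ x` and `V ∋ y`, and consists of all classes `δ⁻¹ · a · ε` with `δ` a path in `U`
starting at `x` and `ε` a path in `V` starting at `y`. -/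
instance : TopologicalSpace (Pi1 X) where
  IsOpen W := ∀ a ∈ W, ∃ U V : Set X, IsOpen U ∧ IsOpen V ∧ a.src ∈ U ∧ a.tgt ∈ V ∧
    ∀ (x y : X) (δ : Path a.src x) (ε : Path a.tgt y),
      (∀ t, δ t ∈ U) → (∀ t, ε t ∈ V) → extend a δ ε ∈ W
  isOpen_univ _ _ := ⟨Set.univ, Set.univ, isOpen_univ, isOpen_univ, trivial, trivial,
    fun _ _ _ _ _ _ => trivial⟩
  isOpen_inter := by
    rintro W W' hW hW' a ⟨ha, ha'⟩
    obtain ⟨U, V, hU, hV, hx, hy, h⟩ := hW a ha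
    obtain ⟨U', V', hU', hV', hx', hy', h'⟩ := hW' a ha'
    exact ⟨U ∩ U', V ∩ V', hU.inter hU', hV.inter hV', ⟨hx, hx'⟩, ⟨hy, hy'⟩,
      fun x y δ ε hδ hε => ⟨h x y δ ε (fun t => (hδ t).1) (fun t => (hε t).1),
        h' x y δ ε (fun t => (hδ t).2) (fun t => (hε t).2)⟩⟩
  isOpen_sUnion := by
    rintro S hS a ⟨W, hWS, ha⟩
    obtain ⟨U, V, hU, hV, hx, hy, h⟩ := hS W hWS a ha
    exact ⟨U, V, hU, hV, hx, hy, fun x y δ ε hδ hε => ⟨W, hWS, h x y δ ε hδ hε⟩⟩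

theorem isOpen_def {W : Set (Pi1 X)} : IsOpen W ↔
    ∀ a ∈ W, ∃ U V : Set X, IsOpen U ∧ IsOpen V ∧ a.src ∈ U ∧ a.tgt ∈ V ∧
    ∀ (x y : X) (δ : Path a.src x) (ε : Path a.tgt y),
      (∀ t, δ t ∈ U) → (∀ t, ε t ∈ V) → extend a δ ε ∈ W := Iff.rfl

/-- The map `(source, target) : π₁ X → X × X`. -/
def ends (a : Pi1 X) : X × X := (a.src, a.tgt)

theorem extend_refl (a : Pi1 X) : extend a (Path.refl _) (Path.refl _) = a := by
  obtain ⟨p, hp⟩ := exists_ofPath a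
  have h : (Path.Homotopic.Quotient.refl a.src).symm = Path.Homotopic.Quotient.refl a.src := by
    rw [← Path.Homotopic.Quotient.mk_refl, ← Path.Homotopic.Quotient.mk_symm, Path.refl_symm]
  simp [extend, h]

theorem symm_trans_class {x y z : X} (p : Path x y) (q : Path y z) :
    (Path.Homotopic.Quotient.mk (p.trans q)).symm =
      (Path.Homotopic.Quotient.mk q).symm.trans (Path.Homotopic.Quotient.mk p).symm := by
  rw [← Path.Homotopic.Quotient.mk_symm, Path.trans_symm]
  rfl

theorem extend_extend (a : Pi1 X) {x y x' y' : X} (δ : Path a.src x) (ε : Path a.tgt y)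
    (δ' : Path x x') (ε' : Path y y') :
    extend (extend a δ ε) (x := x') (y := y') δ' ε' = extend a (δ.trans δ') (ε.trans ε') := by
  simp only [extend]
  rw [symm_trans_class, Path.Homotopic.Quotient.mk_trans]
  simp only [Path.Homotopic.Quotient.trans_assoc]

theorem continuous_ends : Continuous (ends : Pi1 X → X × X) := by
  refine continuous_def.2 fun W hW => isOpen_def.2 fun a ha => ?_
  obtain ⟨U, V, hU, hV, hx, hy, h⟩ := isOpen_prod_iff.1 hW a.src a.tgt ha
  refine ⟨U, V, hU, hV, hx, hy, fun x y δ ε hδ hε => h ⟨?_, ?_⟩⟩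
  · simpa [ends, extend] using hδ 1
  · simpa [ends, extend] using hε 1

theorem isOpenMap_ends [LocallyPathConnectedSpace X] : IsOpenMap (ends : Pi1 X → X × X) := by
  intro W hW
  refine isOpen_iff_mem_nhds.2 ?_
  rintro _ ⟨a, ha, rfl⟩
  obtain ⟨U, V, hU, hV, hx, hy, h⟩ := isOpen_def.1 hW a ha
  refine Filter.mem_of_superset (prod_mem_nhds (pathComponentIn_mem_nhds (hU.mem_nhds hx))
    (pathComponentIn_mem_nhds (hV.mem_nhds hy))) ?_
  rintro ⟨x, y⟩ ⟨⟨δ, hδ⟩, ⟨ε, hε⟩⟩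
  exact ⟨extend a δ ε, h x y δ ε hδ hε, rfl⟩

/-- In a space which is locally path connected and in which paths with common end points inside
a small open set are homotopic, the map `(source, target)` is a local homeomorphism. -/
theorem isLocalHomeomorph_ends_of [LocallyPathConnectedSpace X]
    (hX : ∀ x : X, ∃ U : Set X, IsOpen U ∧ x ∈ U ∧ ∀ (y z : X) (p q : Path y z),
      (∀ t, p t ∈ U) → (∀ t, q t ∈ U) → p.Homotopic q) :
    IsLocalHomeomorph (ends : Pi1 X → X × X) := by
  refine isLocalHomeomorph_iff_isOpenEmbedding_restrict.2 fun a => ?_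
  obtain ⟨U, hU, hx, hUh⟩ := hX a.src
  obtain ⟨V, hV, hy, hVh⟩ := hX a.tgt
  let N : Set (Pi1 X) := {b | ∃ (x y : X) (δ : Path a.src x) (ε : Path a.tgt y),
      (∀ t, δ t ∈ U) ∧ (∀ t, ε t ∈ V) ∧ b = extend a δ ε}
  have htrans : ∀ {S : Set X} {x y z : X} (p : Path x y) (q : Path y z),
      (∀ t, p t ∈ S) → (∀ t, q t ∈ S) → ∀ t, p.trans q t ∈ S := by
    intro S x y z p q hp hq t
    rw [Path.trans_apply]
    split_ifs
    · exact hp _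
    · exact hq _
  have hN : IsOpen N := by
    refine isOpen_def.2 ?_
    rintro _ ⟨x, y, δ, ε, hδ, hε, rfl⟩
    refine ⟨U, V, hU, hV, ?_, ?_, fun x' y' δ' ε' hδ' hε' => ?_⟩
    · simpa [extend] using hδ 1
    · simpa [extend] using hε 1
    · exact ⟨x', y', δ.trans δ', ε.trans ε', htrans _ _ hδ hδ', htrans _ _ hε hε',
        extend_extend a δ ε δ' ε'⟩
  have haN : a ∈ N :=
    ⟨a.src, a.tgt, Path.refl _, Path.refl _, fun _ => hx, fun _ => hy, (extend_refl a).symm⟩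
  refine ⟨N, hN.mem_nhds haN, Topology.IsOpenEmbedding.of_continuous_injective_isOpenMap
    (continuous_ends.comp continuous_subtype_val) ?_
    (isOpenMap_ends.comp hN.isOpenMap_subtype_val)⟩
  rintro ⟨_, x, y, δ, ε, hδ, hε, rfl⟩ ⟨_, x', y', δ', ε', hδ', hε', rfl⟩ h
  have h' : (x, y) = (x', y') := h
  obtain ⟨rfl, rfl⟩ := Prod.mk.inj h'
  refine Subtype.ext ?_
  simp only [extend]
  rw [Path.Homotopic.Quotient.eq.2 (hUh _ _ δ δ' hδ hδ'),
    Path.Homotopic.Quotient.eq.2 (hVh _ _ ε ε' hε hε')]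

/-! ### The lifted smooth structure -/

theorem exists_homotopic_nhds (E : Type*) [NormedAddCommGroup E] [NormedSpace ℝ E] [ChartedSpace E X]
    (x : X) : ∃ U : Set X, IsOpen U ∧ x ∈ U ∧
    ∀ (y z : X) (p q : Path y z), (∀ t, p t ∈ U) → (∀ t, q t ∈ U) → p.Homotopic q := by
  obtain ⟨r, hr, hball⟩ := Metric.isOpen_iff.1 (chartAt E x).open_target _
    (mem_chart_target E x)
  refine ⟨(chartAt E x).source ∩ chartAt E x ⁻¹' Metric.ball (chartAt E x x) r,
    (chartAt E x).isOpen_inter_preimage Metric.isOpen_ball,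
    ⟨mem_chart_source E x, Metric.mem_ball_self hr⟩, fun y z p q hp hq => ?_⟩
  have hcont : ∀ p' : Path y z, (∀ t, p' t ∈ (chartAt E x).source ∩
      chartAt E x ⁻¹' Metric.ball (chartAt E x x) r) →
      Continuous fun t => chartAt E x (p' t) := fun p' hp' =>
    (chartAt E x).continuousOn.comp_continuous p'.continuous fun t => (hp' t).1
  have hmem : ∀ s t : unitInterval, (1 - (s : ℝ)) • chartAt E x (p t) + (s : ℝ) • chartAt E x (q t) ∈
      (chartAt E x).target := fun s t =>
    hball ((convex_ball _ _) (hp t).2 (hq t).2 (sub_nonneg.2 s.2.2) s.2.1 (by ring))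
  have hleft : ∀ w ∈ (chartAt E x).source, (chartAt E x).symm (chartAt E x w) = w :=
    fun w hw => (chartAt E x).left_inv hw
  refine ⟨⟨⟨⟨fun st => (chartAt E x).symm
    ((1 - (st.1 : ℝ)) • chartAt E x (p st.2) + (st.1 : ℝ) • chartAt E x (q st.2)), ?_⟩,
    ?_, ?_⟩, ?_⟩⟩
  · refine (chartAt E x).continuousOn_symm.comp_continuous ?_ fun st => hmem st.1 st.2
    have h1 := (hcont p hp).comp (continuous_snd (X := unitInterval) (Y := unitInterval))
    have h2 := (hcont q hq).comp (continuous_snd (X := unitInterval) (Y := unitInterval))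
    have h3 : Continuous fun st : unitInterval × unitInterval => (st.1 : ℝ) := by fun_prop
    exact ((continuous_const.sub h3).smul h1).add (h3.smul h2)
  · intro t
    simpa using hleft _ (hp t).1
  · intro t
    simpa using hleft _ (hq t).1
  · intro s t ht
    rcases ht with rfl | rfl
    · have hy : y ∈ (chartAt E x).source := by simpa using (hp 0).1
      simp [← add_smul, hleft y hy]
    · have hz : z ∈ (chartAt E x).source := by simpa using (hp 1).1
      simp [← add_smul, hleft z hz]

/-- For a manifold `X`, the map `(source, target) : π₁ X → X × X` is a local homeomorphism. -/
theorem isLocalHomeomorph_ends (E : Type*) [NormedAddCommGroup E] [NormedSpace ℝ E] [ChartedSpace E X] :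
    IsLocalHomeomorph (ends : Pi1 X → X × X) :=
  haveI : LocallyPathConnectedSpace X := ChartedSpace.locallyPathConnectedSpace E X
  isLocalHomeomorph_ends_of (exists_homotopic_nhds E)

/-- The atlas of `π₁ X` lifted from the manifold `X`: its charts are obtained by restricting the map
`(source, target) : π₁ X → X × X` to an open set on which it is a homeomorphism onto an open set,
and composing it with a chart of `X × X`. -/
instance chartedSpace {E : Type*} [NormedAddCommGroup E] [NormedSpace ℝ E]
    [ChartedSpace E X] : ChartedSpace (ModelProd E E) (Pi1 X) where
  atlas := {φ | ∃ e : OpenPartialHomeomorph (Pi1 X) (X × X), (e : Pi1 X → X × X) = ends ∧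
    ∃ c ∈ atlas (ModelProd E E) (X × X), φ = e.trans c}
  chartAt a := ((isLocalHomeomorph_ends E).localInverseAt a).symm.trans
    (chartAt (ModelProd E E) a.ends)
  mem_chart_source a := by simp
  chart_mem_atlas a := ⟨_, by simp, _, chart_mem_atlas _ _, rfl⟩

end Pi1

end

/-! The lifted structures reduce every smoothness question about `π₁ X` to two simpler ones. The
charts of `π₁ X` are charts of `X × X` composed with `ends`, so a map into `π₁ X` is smooth as soon
as it is continuous and its composite with `ends` is smooth (`contMDiff_of_ends`). For each
structure map that composite is an evident combination of `src`, `tgt` and smooth maps of the base,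
so only continuity takes work.

Continuity is checked on the basic neighbourhoods, through identities saying how an operation acts
on `δ⁻¹ · a · ε` (`map_extend`, `pair_extend`, `comp_extend`). Composition and the Hausdorff
property also need small open sets in which paths with common end points are homotopic; coordinate
balls supply them.

The algebraic laws hold already for representing paths. Mapping and pairing commute with
concatenation pointwise in the parameter, since concatenation always switches paths at the same
time. This yields functoriality on arrows and the interchange law. -/

namespace Pi1

/-! ### Continuity of the groupoid operations in the lifted topology. -/

section Topology

variable {X Y : Type*} [TopologicalSpace X] [TopologicalSpace Y]

/-- The basic neighbourhood of the class `a` given by sets `U` and `V`: all classes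
`δ⁻¹ · a · ε` with `δ` a path in `U` and `ε` a path in `V`. -/
def basicNhd (a : Pi1 X) (U V : Set X) : Set (Pi1 X) :=
  {b | ∃ (x y : X) (δ : Path a.src x) (ε : Path a.tgt y),
    (∀ t, δ t ∈ U) ∧ (∀ t, ε t ∈ V) ∧ b = extend a δ ε}

theorem trans_mem {S : Set X} {x y z : X} {p : Path x y} {q : Path y z}
    (hp : ∀ t, p t ∈ S) (hq : ∀ t, q t ∈ S) (t : unitInterval) : p.trans q t ∈ S := by
  rw [Path.trans_apply]
  split_ifs
  · exact hp _
  · exact hq _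

theorem isOpen_basicNhd (a : Pi1 X) {U V : Set X} (hU : IsOpen U) (hV : IsOpen V) :
    IsOpen (basicNhd a U V) := by
  refine isOpen_def.2 ?_
  rintro _ ⟨x, y, δ, ε, hδ, hε, rfl⟩
  refine ⟨U, V, hU, hV, ?_, ?_, fun x' y' δ' ε' hδ' hε' => ?_⟩
  · simpa [extend] using hδ 1
  · simpa [extend] using hε 1
  · exact ⟨x', y', δ.trans δ', ε.trans ε', trans_mem hδ hδ', trans_mem hε hε',
      extend_extend a δ ε δ' ε'⟩

theorem mem_basicNhd_self (a : Pi1 X) {U V : Set X} (hU : a.src ∈ U) (hV : a.tgt ∈ V) :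
    a ∈ basicNhd a U V :=
  ⟨a.src, a.tgt, Path.refl _, Path.refl _, fun _ => hU, fun _ => hV, (extend_refl a).symm⟩

theorem basicNhd_mem_nhds (a : Pi1 X) {U V : Set X} (hU : IsOpen U) (hV : IsOpen V)
    (haU : a.src ∈ U) (haV : a.tgt ∈ V) : basicNhd a U V ∈ 𝓝 a :=
  (isOpen_basicNhd a hU hV).mem_nhds (mem_basicNhd_self a haU haV)

theorem exists_basicNhd_subset {a : Pi1 X} {W : Set (Pi1 X)} (hW : W ∈ 𝓝 a) :
    ∃ U V : Set X, IsOpen U ∧ IsOpen V ∧ a.src ∈ U ∧ a.tgt ∈ V ∧ basicNhd a U V ⊆ W := by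
  obtain ⟨W', hW'W, hW', ha⟩ := mem_nhds_iff.1 hW
  obtain ⟨U, V, hU, hV, hx, hy, h⟩ := isOpen_def.1 hW' a ha
  refine ⟨U, V, hU, hV, hx, hy, ?_⟩
  rintro _ ⟨x, y, δ, ε, hδ, hε, rfl⟩
  exact hW'W (h x y δ ε hδ hε)

/-- For a representative of `a`, both sides are classes of one and the same path, so no homotopy is
needed. This gives continuity of `map f`. -/
theorem map_extend (f : C(X, Y)) (a : Pi1 X) {x y : X} (δ : Path a.src x) (ε : Path a.tgt y) :
    map f (extend a δ ε) =
      extend (map f a) (δ.map f.continuous) (ε.map f.continuous) := by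
  obtain ⟨u, v, c⟩ := a
  induction c using Path.Homotopic.Quotient.ind with
  | mk p =>
    refine ofPath_congr ((δ.symm.trans (p.trans ε)).map f.continuous)
      ((δ.map f.continuous).symm.trans ((p.map f.continuous).trans (ε.map f.continuous)))
      fun t => ?_
    rw [Path.map_trans, Path.map_trans, Path.map_symm]

theorem continuous_map (f : C(X, Y)) : Continuous (map f) := by
  refine continuous_iff_continuousAt.2 fun a W hW => ?_
  obtain ⟨U, V, hU, hV, hx, hy, h⟩ := exists_basicNhd_subset hW
  refine Filter.mem_map.2 <| Filter.mem_of_superset (basicNhd_mem_nhds a (hU.preimage f.continuous)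
    (hV.preimage f.continuous) hx hy) ?_
  rintro _ ⟨x, y, δ, ε, hδ, hε, rfl⟩
  exact h ⟨_, _, δ.map f.continuous, ε.map f.continuous, hδ, hε, map_extend f a δ ε⟩

/-- The class of `t ↦ (p t, q t)`. -/
def pair (a : Pi1 X) (b : Pi1 Y) : Pi1 (X × Y) :=
  ⟨(a.src, b.src), (a.tgt, b.tgt), Path.Homotopic.prod a.cls b.cls⟩

theorem pair_extend (a : Pi1 X) (b : Pi1 Y) {x y : X} {x' y' : Y}
    (δ : Path a.src x) (ε : Path a.tgt y) (δ' : Path b.src x') (ε' : Path b.tgt y') :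
    pair (extend a δ ε) (extend b δ' ε') = extend (pair a b) (δ.prod δ') (ε.prod ε') := by
  obtain ⟨u, v, c⟩ := a
  obtain ⟨u', v', c'⟩ := b
  induction c using Path.Homotopic.Quotient.ind with
  | mk p =>
  induction c' using Path.Homotopic.Quotient.ind with
  | mk p' =>
    refine ofPath_congr ((δ.symm.trans (p.trans ε)).prod (δ'.symm.trans (p'.trans ε')))
      ((δ.prod δ').symm.trans ((p.prod p').trans (ε.prod ε'))) fun t => ?_
    rw [← Path.trans_prod_eq_prod_trans, ← Path.trans_prod_eq_prod_trans]
    rfl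

theorem continuous_pair : Continuous fun p : Pi1 X × Pi1 Y => pair p.1 p.2 := by
  refine continuous_iff_continuousAt.2 ?_
  rintro ⟨a, b⟩ W hW
  obtain ⟨U, V, hU, hV, hx, hy, h⟩ := exists_basicNhd_subset hW
  obtain ⟨U₁, U₂, hU₁, hU₂, hx₁, hx₂, hUU⟩ := isOpen_prod_iff.1 hU a.src b.src hx
  obtain ⟨V₁, V₂, hV₁, hV₂, hy₁, hy₂, hVV⟩ := isOpen_prod_iff.1 hV a.tgt b.tgt hy
  refine Filter.mem_map.2 <| Filter.mem_of_superset (prod_mem_nhds (basicNhd_mem_nhds a hU₁ hV₁ hx₁ hy₁)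
    (basicNhd_mem_nhds b hU₂ hV₂ hx₂ hy₂)) ?_
  rintro ⟨_, _⟩ ⟨⟨x, y, δ, ε, hδ, hε, rfl⟩, ⟨x', y', δ', ε', hδ', hε', rfl⟩⟩
  exact h ⟨_, _, δ.prod δ', ε.prod ε', fun t => hUU ⟨hδ t, hδ' t⟩, fun t => hVV ⟨hε t, hε' t⟩,
    pair_extend a b δ ε δ' ε'⟩

theorem continuous_groupoid_unit [LocallyPathConnectedSpace X] : Continuous (groupoid X).unit := by
  refine continuous_iff_continuousAt.2 fun x W hW => ?_
  obtain ⟨U, V, hU, hV, hx, hy, h⟩ := exists_basicNhd_subset hW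
  refine Filter.mem_map.2 <| Filter.mem_of_superset
    (pathComponentIn_mem_nhds ((hU.inter hV).mem_nhds (x := x) ⟨hx, hy⟩)) ?_
  rintro y ⟨δ, hδ⟩
  -- The unit at a nearby `y` is `δ⁻¹ · 1ₓ · δ`, with the same `δ` at both ends; hence `δ` was
  -- chosen in `U ∩ V`.
  exact h ⟨y, y, δ, δ, fun t => (hδ t).1, fun t => (hδ t).2, by simp [groupoid, extend]⟩

theorem continuous_groupoid_inv : Continuous (groupoid X).inv := by
  refine continuous_iff_continuousAt.2 fun a W hW => ?_
  obtain ⟨U, V, hU, hV, hx, hy, h⟩ := exists_basicNhd_subset hW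
  -- `(δ⁻¹ · a · ε)⁻¹ = ε⁻¹ · a⁻¹ · δ`, so `U` and `V` trade places.
  refine Filter.mem_map.2 <| Filter.mem_of_superset (basicNhd_mem_nhds a hV hU hy hx) ?_
  rintro _ ⟨x, y, δ, ε, hδ, hε, rfl⟩
  refine h ⟨y, x, ε, δ, hε, hδ, ?_⟩
  obtain ⟨u, v, c⟩ := a
  induction c using Path.Homotopic.Quotient.ind with
  | mk p =>
    simp only [groupoid, extend, ← Path.Homotopic.Quotient.mk_trans,
      ← Path.Homotopic.Quotient.mk_symm, Path.trans_symm, Path.symm_symm]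
    simp only [Path.Homotopic.Quotient.mk_trans, Path.Homotopic.Quotient.trans_assoc]

/-- Every point has a neighbourhood in which paths with common end points are homotopic. -/
def HomotopicNhds (X : Type*) [TopologicalSpace X] : Prop :=
  ∀ x : X, ∃ U : Set X, IsOpen U ∧ x ∈ U ∧ ∀ (y z : X) (p q : Path y z),
    (∀ t, p t ∈ U) → (∀ t, q t ∈ U) → p.Homotopic q

/-- In `δ⁻¹ · a · ε · δ'⁻¹ · b · ε'` the middle factor `ε · δ'⁻¹` cancels, because `δ'` and `ε` are
homotopic. -/
theorem comp_extend (b a : Pi1 X) (h : b.src = a.tgt) {x y y' z : X} (δ : Path a.src x)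
    (ε : Path a.tgt y) (δ' : Path b.src y') (ε' : Path b.tgt z) (hy : y' = y)
    (hεδ : (δ'.cast h.symm hy.symm).Homotopic ε) :
    comp (extend b δ' ε') (extend a δ ε) hy = extend (comp b a h) δ ε' := by
  obtain ⟨u, v, c⟩ := a
  obtain ⟨u', v', c'⟩ := b
  dsimp only at h
  subst h hy
  have hεδ' := Path.Homotopic.Quotient.eq.2 hεδ
  simp only [Path.cast_rfl_rfl] at hεδ'
  simp only [comp, extend, Path.Homotopic.Quotient.cast_rfl_rfl, hεδ',
    Path.Homotopic.Quotient.trans_assoc]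
  congr 3
  rw [← Path.Homotopic.Quotient.trans_assoc]
  simp

theorem compPair_of_eq {b a : Pi1 X} (h : b.src = a.tgt) :
    (groupoid X).compPair (b, a) = comp b a h :=
  dif_pos h

theorem continuousOn_compPair (hX : HomotopicNhds X) :
    ContinuousOn (groupoid X).compPair (groupoid X).composable := by
  rintro ⟨b, a⟩ (h : b.src = a.tgt) W hW
  rw [compPair_of_eq h] at hW
  obtain ⟨U, V, hU, hV, hx, hy, hUV⟩ := exists_basicNhd_subset hW
  -- `T` surrounds the junction point. For composable neighbours of `b` and `a`, the inner paths
  -- `δ'` and `ε` lie in `T` and share both end points, hence are homotopic.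
  obtain ⟨T, hT, haT, hTh⟩ := hX a.tgt
  have hbT : b.src ∈ T := h ▸ haT
  refine Filter.mem_map.2 <| Filter.mem_of_superset (inter_mem_nhdsWithin _ (prod_mem_nhds
    (basicNhd_mem_nhds b hT hV hbT hy) (basicNhd_mem_nhds a hU hT hx haT))) ?_
  rintro ⟨_, _⟩ ⟨hc, ⟨y', z, δ', ε', hδ', hε', rfl⟩, ⟨x, y, δ, ε, hδ, hε, rfl⟩⟩
  have hy' : y' = y := hc
  rw [Set.mem_preimage, compPair_of_eq hc]
  refine hUV ⟨x, z, δ, ε', hδ, hε', ?_⟩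
  exact comp_extend b a h δ ε δ' ε' hy' (hTh _ _ _ _ hδ' hε)

theorem t2Space [T2Space X] (hX : HomotopicNhds X) : T2Space (Pi1 X) := by
  refine ⟨fun a b hab => ?_⟩
  by_cases he : ends a = ends b
  · obtain ⟨u, v, c⟩ := a
    obtain ⟨u', v', c'⟩ := b
    obtain ⟨rfl, rfl⟩ := Prod.mk.inj he
    obtain ⟨U, hU, hx, hUh⟩ := hX u
    obtain ⟨V, hV, hy, hVh⟩ := hX v
    -- Distinct classes with the same end points are separated by the sheets over the same `U` and
    -- `V`: a common element would give `δ⁻¹ · a · ε = δ'⁻¹ · b · ε'` with `δ ~ δ'` and `ε ~ ε'`,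
    -- and cancelling yields `a = b`.
    refine ⟨basicNhd _ U V, basicNhd _ U V, isOpen_basicNhd _ hU hV, isOpen_basicNhd _ hU hV,
      mem_basicNhd_self _ hx hy, mem_basicNhd_self _ hx hy, Set.disjoint_left.2 ?_⟩
    rintro _ ⟨x, y, δ, ε, hδ, hε, rfl⟩ ⟨x', y', δ', ε', hδ', hε', h⟩
    obtain ⟨rfl, rfl⟩ : x = x' ∧ y = y' := ⟨congrArg src h, congrArg tgt h⟩
    have h1 := Path.Homotopic.Quotient.eq.2 (hUh _ _ δ δ' hδ hδ')
    have h2 := Path.Homotopic.Quotient.eq.2 (hVh _ _ ε ε' hε hε')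
    simp only [extend, h1, h2, mk.injEq, heq_eq_eq, true_and] at h
    have h3 := congrArg (fun γ => (Path.Homotopic.Quotient.mk δ').trans
      (γ.trans (Path.Homotopic.Quotient.mk ε').symm)) h
    simp only [Path.Homotopic.Quotient.trans_assoc] at h3
    simp only [Path.Homotopic.Quotient.trans_symm, Path.Homotopic.Quotient.trans_refl] at h3
    simp only [← Path.Homotopic.Quotient.trans_assoc, Path.Homotopic.Quotient.trans_symm,
      Path.Homotopic.Quotient.refl_trans] at h3
    exact hab (by rw [h3])
  · obtain ⟨u, v, hu, hv, hau, hbv, huv⟩ := t2_separation he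
    exact ⟨ends ⁻¹' u, ends ⁻¹' v, hu.preimage continuous_ends, hv.preimage continuous_ends,
      hau, hbv, huv.preimage _⟩

end Topology

/-! ### The lifted smooth structure and the Lie groupoid axioms. -/

section Manifold

variable {E : Type*} [NormedAddCommGroup E] [NormedSpace ℝ E]
  {X : Type*} [TopologicalSpace X] [ChartedSpace E X]

theorem chartAt_apply (a b : Pi1 X) :
    chartAt (ModelProd E E) a b = chartAt (ModelProd E E) a.ends b.ends := by
  change (((isLocalHomeomorph_ends E).localInverseAt a).symm.trans
    (chartAt (ModelProd E E) a.ends)) b = _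
  rw [OpenPartialHomeomorph.coe_trans, IsLocalHomeomorph.localInverseAt_symm]
  rfl

variable (E) in
-- An equality of total functions, with no restriction to the chart domain. It lets coordinate
-- expressions on `π₁ X` be exchanged for those on `X × X`.
theorem extChartAt_eq (a : Pi1 X) :
    ⇑(extChartAt (𝓘(ℝ, E).prod 𝓘(ℝ, E)) a) =
      extChartAt (𝓘(ℝ, E).prod 𝓘(ℝ, E)) a.ends ∘ ends := by
  ext1 b
  simp only [extChartAt, OpenPartialHomeomorph.extend_coe, Function.comp_apply, chartAt_apply]

/-- The lifted atlas makes `π₁ X` a smooth manifold. -/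
instance isManifold [IsManifold 𝓘(ℝ, E) ∞ X] :
    IsManifold (𝓘(ℝ, E).prod 𝓘(ℝ, E)) ∞ (Pi1 X) := by
  refine isManifold_of_contDiffOn _ _ _ ?_
  rintro _ _ ⟨e, he, c, hc, rfl⟩ ⟨e', he', c', hc', rfl⟩
  have h := (contDiffGroupoid ∞ (𝓘(ℝ, E).prod 𝓘(ℝ, E))).compatible hc hc'
  rw [contDiffGroupoid, mem_groupoid_of_pregroupoid] at h
  -- Both `e` and `e'` are restrictions of `ends`, so `e' ∘ e⁻¹` is the identity where defined, and
  -- the transition map is a restriction of `c' ∘ c⁻¹`.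
  have hmid : ∀ z ∈ ((e.trans c).symm.trans (e'.trans c')).source,
      e' (e.symm (c.symm z)) = c.symm z := fun z hz => by
    have hz' : c.symm z ∈ e.target := hz.1.2
    rw [he', ← he, e.right_inv hz']
  refine h.1.congr_mono (fun z hz => ?_) (Set.inter_subset_inter_left _
    (Set.preimage_mono fun z hz => ⟨hz.1.1, ?_⟩))
  · exact congrArg (fun w => (𝓘(ℝ, E).prod 𝓘(ℝ, E)) (c' w)) (hmid _ hz.1)
  · have hz' : e' (e.symm (c.symm z)) ∈ c'.source := hz.2.2
    rwa [hmid z hz] at hz'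

variable {E' : Type*} [NormedAddCommGroup E'] [NormedSpace ℝ E']
  {H' : Type*} [TopologicalSpace H'] {I' : ModelWithCorners ℝ E' H'}
  {M : Type*} [TopologicalSpace M] [ChartedSpace H' M]

/-- A map into `π₁ X` is smooth if it is continuous and its composite with `(source, target)`
is smooth. -/
theorem contMDiffWithinAt_of_ends {f : M → Pi1 X} {s : Set M} {x : M}
    (hf : ContinuousWithinAt f s x)
    (h : ContMDiffWithinAt I' (𝓘(ℝ, E).prod 𝓘(ℝ, E)) ∞ (ends ∘ f) s x) :
    ContMDiffWithinAt I' (𝓘(ℝ, E).prod 𝓘(ℝ, E)) ∞ f s x := by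
  rw [contMDiffWithinAt_iff_target] at h ⊢
  rw [extChartAt_eq]
  exact ⟨hf, h.2⟩

theorem contMDiff_of_ends {f : M → Pi1 X} (hf : Continuous f)
    (h : ContMDiff I' (𝓘(ℝ, E).prod 𝓘(ℝ, E)) ∞ (ends ∘ f)) :
    ContMDiff I' (𝓘(ℝ, E).prod 𝓘(ℝ, E)) ∞ f := fun x =>
  contMDiffWithinAt_of_ends hf.continuousWithinAt (h x)

variable (E X) in
theorem contMDiff_ends :
    ContMDiff (𝓘(ℝ, E).prod 𝓘(ℝ, E)) (𝓘(ℝ, E).prod 𝓘(ℝ, E)) ∞ (ends : Pi1 X → X × X) := by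
  intro a
  refine contMDiffWithinAt_iff_target.2 ⟨continuous_ends.continuousWithinAt, ?_⟩
  rw [← extChartAt_eq]
  exact contMDiffAt_extChartAt

variable (E X) in
theorem contMDiff_src : ContMDiff (𝓘(ℝ, E).prod 𝓘(ℝ, E)) 𝓘(ℝ, E) ∞ (src : Pi1 X → X) :=
  contMDiff_fst.comp (contMDiff_ends E X)

variable (E X) in
theorem contMDiff_tgt : ContMDiff (𝓘(ℝ, E).prod 𝓘(ℝ, E)) 𝓘(ℝ, E) ∞ (tgt : Pi1 X → X) :=
  contMDiff_snd.comp (contMDiff_ends E X)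

theorem chartAt_ends_chartAt_symm (a : Pi1 X) {z : ModelProd E E}
    (hz : z ∈ (chartAt (ModelProd E E) a).target) :
    (chartAt E a.src ((chartAt (ModelProd E E) a).symm z).src,
      chartAt E a.tgt ((chartAt (ModelProd E E) a).symm z).tgt) = z := by
  have h := (chartAt (ModelProd E E) a).right_inv hz
  rw [chartAt_apply] at h
  exact h

variable [IsManifold 𝓘(ℝ, E) ∞ X]

variable (E X) in
-- In the lifted charts the source is the first projection `E × E → E`, already in normal form with
-- complement `E`.
theorem isSubmersion_src :
    Manifold.IsSubmersion (𝓘(ℝ, E).prod 𝓘(ℝ, E)) 𝓘(ℝ, E) ∞ (src : Pi1 X → X) := by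
  have h : Manifold.IsSubmersionOfComplement E (𝓘(ℝ, E).prod 𝓘(ℝ, E)) 𝓘(ℝ, E) ∞
      (src : Pi1 X → X) := fun a => by
    refine .mk_of_continuousAt (contMDiff_src E X).continuous.continuousAt
      (ContinuousLinearEquiv.refl ℝ (E × E)) (chartAt _ a) (chartAt E a.src)
      (mem_chart_source _ _) (mem_chart_source _ _) (IsManifold.chart_mem_maximalAtlas _)
      (IsManifold.chart_mem_maximalAtlas _) fun z hz => ?_
    have hz' : z ∈ (chartAt (ModelProd E E) a).target := by
      rw [OpenPartialHomeomorph.extend_target] at hz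
      exact hz.1
    exact congrArg Prod.fst (chartAt_ends_chartAt_symm a hz')
  exact h.isSubmersion

variable (E X) in
theorem isSubmersion_tgt :
    Manifold.IsSubmersion (𝓘(ℝ, E).prod 𝓘(ℝ, E)) 𝓘(ℝ, E) ∞ (tgt : Pi1 X → X) := by
  have h : Manifold.IsSubmersionOfComplement E (𝓘(ℝ, E).prod 𝓘(ℝ, E)) 𝓘(ℝ, E) ∞
      (tgt : Pi1 X → X) := fun a => by
    refine .mk_of_continuousAt (contMDiff_tgt E X).continuous.continuousAt
      -- The target reads as the second projection; swapping the factors brings it to the normal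
      -- form.
      (ContinuousLinearEquiv.prodComm ℝ E E) (chartAt _ a) (chartAt E a.tgt)
      (mem_chart_source _ _) (mem_chart_source _ _) (IsManifold.chart_mem_maximalAtlas _)
      (IsManifold.chart_mem_maximalAtlas _) fun z hz => ?_
    have hz' : z ∈ (chartAt (ModelProd E E) a).target := by
      rw [OpenPartialHomeomorph.extend_target] at hz
      exact hz.1
    exact congrArg Prod.snd (chartAt_ends_chartAt_symm a hz')
  exact h.isSubmersion

variable (E X) in
/-- The fundamental groupoid of a Hausdorff manifold is a Lie groupoid. -/
theorem isLieGroupoid [FiniteDimensional ℝ E] [T2Space X] :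
    IsLieGroupoid (𝓘(ℝ, E).prod 𝓘(ℝ, E)) 𝓘(ℝ, E) (groupoid X) := by
  have : LocallyPathConnectedSpace X := ChartedSpace.locallyPathConnectedSpace E X
  have : T2Space (Pi1 X) := t2Space (exists_homotopic_nhds E)
  exact
  { finiteDimensional_arrows := inferInstance
    finiteDimensional_objects := inferInstance
    boundaryless_arrows := inferInstance
    boundaryless_objects := inferInstance
    isManifold_arrows := inferInstance
    isManifold_objects := inferInstance
    t2_objects := inferInstance
    t2_fibre := fun _ => inferInstance
    src_surjective := fun x => ⟨(groupoid X).unit x, rfl⟩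
    tgt_surjective := fun x => ⟨(groupoid X).unit x, rfl⟩
    src_submersion := isSubmersion_src E X
    tgt_submersion := isSubmersion_tgt E X
    comp_smooth := fun p hp => by
      refine contMDiffWithinAt_of_ends (continuousOn_compPair (exists_homotopic_nhds E) p hp) ?_
      -- On composable pairs the end points of `b ∘ a` are `(src a, tgt b)`, an expression that is
      -- smooth on all pairs.
      have h : ContMDiff ((𝓘(ℝ, E).prod 𝓘(ℝ, E)).prod (𝓘(ℝ, E).prod 𝓘(ℝ, E)))
          (𝓘(ℝ, E).prod 𝓘(ℝ, E)) ∞ fun q : Pi1 X × Pi1 X => (q.2.src, q.1.tgt) :=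
        ((contMDiff_src E X).comp contMDiff_snd).prodMk ((contMDiff_tgt E X).comp contMDiff_fst)
      refine (h.contMDiffOn (s := (groupoid X).composable)).congr ?_ p hp
      rintro ⟨b, a⟩ hba
      rw [Function.comp_apply, compPair_of_eq hba]
      rfl
    unit_smooth := contMDiff_of_ends continuous_groupoid_unit (contMDiff_id.prodMk contMDiff_id)
    inv_smooth := contMDiff_of_ends continuous_groupoid_inv
      ((contMDiff_tgt E X).prodMk (contMDiff_src E X)) }

end Manifold

/-! ### Induced maps: smoothness and functoriality. -/

section Map

variable {E F : Type*} [NormedAddCommGroup E] [NormedSpace ℝ E]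
  [NormedAddCommGroup F] [NormedSpace ℝ F]
  {X Y : Type*} [TopologicalSpace X] [ChartedSpace E X]
  [TopologicalSpace Y] [ChartedSpace F Y]

theorem contMDiff_map (f : C(X, Y)) (hf : ContMDiff 𝓘(ℝ, E) 𝓘(ℝ, F) ∞ f) :
    ContMDiff (𝓘(ℝ, E).prod 𝓘(ℝ, E)) (𝓘(ℝ, F).prod 𝓘(ℝ, F)) ∞ (map f) :=
  contMDiff_of_ends (continuous_map f)
    ((hf.comp (contMDiff_src E X)).prodMk (hf.comp (contMDiff_tgt E X)))

theorem isGroupoidHom_map (f : C(X, Y)) :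
    IsGroupoidHom (groupoid X) (groupoid Y) (map f) f where
  src_map _ := rfl
  tgt_map _ := rfl
  map_comp b a h := by
    obtain ⟨u, v, c⟩ := a
    obtain ⟨u', v', c'⟩ := b
    obtain rfl : u' = v := h
    induction c using Path.Homotopic.Quotient.ind with
    | mk p =>
    induction c' using Path.Homotopic.Quotient.ind with
    | mk q =>
      refine ofPath_congr ((p.trans q).map f.continuous)
        ((p.map f.continuous).trans (q.map f.continuous)) fun t => ?_
      rw [Path.map_trans]

theorem map_id : map (ContinuousMap.id X) = id := by
  ext1 a
  obtain ⟨p, hp⟩ := exists_ofPath a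
  rw [hp]
  exact ofPath_congr _ _ fun _ => rfl

theorem map_comp {Z : Type*} [TopologicalSpace Z] (g : C(Y, Z)) (f : C(X, Y)) :
    map (g.comp f) = map g ∘ map f := by
  ext1 a
  obtain ⟨p, hp⟩ := exists_ofPath a
  rw [hp]
  rfl

end Map

/-! ### The group structure on arrows and the interchange law. -/

section LieGroup

variable {E : Type*} [NormedAddCommGroup E] [NormedSpace ℝ E]
  {X : Type*} [TopologicalSpace X] [Group X] [IsTopologicalGroup X]

/-- Concatenations switch paths at the same parameter, so the pointwise product of two
concatenations is, as a path, the concatenation of the pointwise products. -/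
theorem comp_mul_comp (b a d c : Pi1 X) (hba : b.src = a.tgt) (hdc : d.src = c.tgt)
    (h : (b * d).src = (a * c).tgt) :
    comp b a hba * comp d c hdc = comp (b * d) (a * c) h := by
  obtain ⟨x, y, a⟩ := a
  obtain ⟨y₁, z, b⟩ := b
  obtain ⟨x', y', c⟩ := c
  obtain ⟨y₁', z', d⟩ := d
  obtain rfl : y₁ = y := hba
  obtain rfl : y₁' = y' := hdc
  induction a using Path.Homotopic.Quotient.ind with
  | mk a =>
  induction b using Path.Homotopic.Quotient.ind with
  | mk b =>
  induction c using Path.Homotopic.Quotient.ind with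
  | mk c =>
  induction d using Path.Homotopic.Quotient.ind with
  | mk d =>
    refine ofPath_congr
      (((a.trans b).prod (c.trans d)).map (f := fun z : X × X => z.1 * z.2) continuous_mul)
      (((a.prod c).map (f := fun z : X × X => z.1 * z.2) continuous_mul).trans
        ((b.prod d).map (f := fun z : X × X => z.1 * z.2) continuous_mul)) fun t => ?_
    rw [← Path.map_trans, Path.trans_prod_eq_prod_trans]

theorem map_mul_of {Y : Type*} [TopologicalSpace Y] [Group Y] [IsTopologicalGroup Y]
    (f : C(X, Y)) (hf : ∀ x y, f (x * y) = f x * f y) (a b : Pi1 X) :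
    map f (a * b) = map f a * map f b := by
  obtain ⟨p, hp⟩ := exists_ofPath a
  obtain ⟨q, hq⟩ := exists_ofPath b
  rw [hp, hq]
  exact ofPath_congr _ _ fun t => hf _ _

variable [ChartedSpace E X]

theorem contMDiff_mul_pi1 [LieGroup 𝓘(ℝ, E) ∞ X] :
    ContMDiff ((𝓘(ℝ, E).prod 𝓘(ℝ, E)).prod (𝓘(ℝ, E).prod 𝓘(ℝ, E)))
      (𝓘(ℝ, E).prod 𝓘(ℝ, E)) ∞ fun p : Pi1 X × Pi1 X => p.1 * p.2 := by
  -- By definition, multiplication of arrows is `pair` followed by the map induced by the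
  -- multiplication of `X`.
  refine contMDiff_of_ends ((continuous_map ⟨fun z : X × X => z.1 * z.2, continuous_mul⟩).comp
    continuous_pair) ?_
  have h1 := contMDiff_src E X
  have h2 := contMDiff_tgt E X
  exact ((h1.comp contMDiff_fst).mul (h1.comp contMDiff_snd)).prodMk
    ((h2.comp contMDiff_fst).mul (h2.comp contMDiff_snd))

theorem contMDiff_inv_pi1 [LieGroup 𝓘(ℝ, E) ∞ X] :
    ContMDiff (𝓘(ℝ, E).prod 𝓘(ℝ, E)) (𝓘(ℝ, E).prod 𝓘(ℝ, E)) ∞ fun a : Pi1 X => a⁻¹ :=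
  contMDiff_map ⟨fun x : X => x⁻¹, continuous_inv⟩ (contMDiff_inv 𝓘(ℝ, E) ∞)

variable (E X) in
/-- The fundamental groupoid of a Hausdorff Lie group is a Lie group-groupoid. -/
theorem isLieGroupGroupoid [FiniteDimensional ℝ E] [LieGroup 𝓘(ℝ, E) ∞ X] [T2Space X] :
    IsLieGroupGroupoid (𝓘(ℝ, E).prod 𝓘(ℝ, E)) 𝓘(ℝ, E) (groupoid X) where
  lieGroupoid := isLieGroupoid E X
  lieGroup_arrows :=
    { contMDiff_mul := contMDiff_mul_pi1
      contMDiff_inv := contMDiff_inv_pi1 }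
  lieGroup_objects := inferInstance
  mul_hom :=
    { src_map := fun _ => rfl
      tgt_map := fun _ => rfl
      map_comp := fun b a h =>
        comp_mul_comp b.1 a.1 b.2 a.2 (congrArg Prod.fst h) (congrArg Prod.snd h)
          (congrArg (fun p : X × X => p.1 * p.2) h)
      smooth_arrows := contMDiff_mul_pi1
      smooth_objects := contMDiff_mul 𝓘(ℝ, E) ∞ }
  one_hom :=
    { src_map := fun _ => rfl
      tgt_map := fun _ => rfl
      map_comp := fun _ _ _ => ((groupoid X).comp_unit 1).symm }
  inv_hom :=
    -- Inversion need not be a group homomorphism, but continuity suffices for it to induce a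
    -- groupoid morphism.
    { toIsGroupoidHom := isGroupoidHom_map (⟨fun x : X => x⁻¹, continuous_inv⟩ : C(X, X))
      smooth_arrows := contMDiff_inv_pi1
      smooth_objects := contMDiff_inv 𝓘(ℝ, E) ∞ }
  interchange := comp_mul_comp

end LieGroup

end Pi1

/-! ### The proposition, assembled. -/

theorem mainTheorem7
    {E F : Type*} [NormedAddCommGroup E] [NormedSpace ℝ E] [FiniteDimensional ℝ E]
    [NormedAddCommGroup F] [NormedSpace ℝ F] [FiniteDimensional ℝ F]
    {H G : Type*}
    [TopologicalSpace H] [ChartedSpace E H] [Group H] [IsTopologicalGroup H]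
    [LieGroup 𝓘(ℝ, E) ∞ H] [T2Space H] [ConnectedSpace H]
    [TopologicalSpace G] [ChartedSpace F G] [Group G] [IsTopologicalGroup G]
    [LieGroup 𝓘(ℝ, F) ∞ G] [T2Space G] [ConnectedSpace G]
    (f : ContMDiffMonoidMorphism 𝓘(ℝ, E) 𝓘(ℝ, F) ∞ H G) :
    IsLieGroupGroupoid (𝓘(ℝ, E).prod 𝓘(ℝ, E)) 𝓘(ℝ, E) (Pi1.groupoid H) ∧
    IsLieGroupGroupoid (𝓘(ℝ, F).prod 𝓘(ℝ, F)) 𝓘(ℝ, F) (Pi1.groupoid G) ∧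
    IsLieGroupGroupoidHom (𝓘(ℝ, E).prod 𝓘(ℝ, E)) 𝓘(ℝ, E)
      (𝓘(ℝ, F).prod 𝓘(ℝ, F)) 𝓘(ℝ, F) (Pi1.groupoid H) (Pi1.groupoid G)
      (Pi1.map (f : C(H, G))) f ∧
    Pi1.map (ContinuousMap.id H) = id ∧
    ∀ {F' : Type*} [NormedAddCommGroup F'] [NormedSpace ℝ F'] [FiniteDimensional ℝ F']
      {K : Type*} [TopologicalSpace K] [ChartedSpace F' K] [Group K] [IsTopologicalGroup K]
      [LieGroup 𝓘(ℝ, F') ∞ K] [T2Space K] [ConnectedSpace K]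
      (g : ContMDiffMonoidMorphism 𝓘(ℝ, F) 𝓘(ℝ, F') ∞ G K),
      Pi1.map ((g : C(G, K)).comp (f : C(H, G))) =
        Pi1.map (g : C(G, K)) ∘ Pi1.map (f : C(H, G)) :=
  ⟨Pi1.isLieGroupGroupoid E H, Pi1.isLieGroupGroupoid F G,
    { toIsGroupoidHom := Pi1.isGroupoidHom_map (f : C(H, G))
      smooth_arrows := Pi1.contMDiff_map (f : C(H, G)) f.contMDiff_toFun
      smooth_objects := f.contMDiff_toFun
      map_mul := Pi1.map_mul_of (f : C(H, G)) f.map_mul' },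
    Pi1.map_id, fun g => Pi1.map_comp _ _⟩
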